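/- Let $(a_{ij})_{i,j=1}^{l}$ be a symmetrizable generalized Cartan matrix: $a_{ii}=2$, $a_{ij}\in\mathbb Z_{\le 0}$ for $i\neq j$, $a_{ij}=0$ implies $a_{ji}=0$, and there are coprime positive integers $d_1,\dots,d_l$ such that the matrix $b_{ij}=d_ia_{ij}$ is symmetric. Let $q\in\mathbb C$, $0<|q|<1$, $q_i=q^{d_i}$, and $$[n]_t=\frac{t^n-t^{-n}}{t-t^{-1}},\qquad [n]_t!=[n]_t\cdots[1]_t,\qquad \begin{bmatrix} m\\ k\end{bmatrix}_t=\frac{[m]_t!}{[k]_t!\,[m-k]_t!}.$$ All series below are formal power series with complex coefficients, infinite in both directions in each variable. The product of finitely many such series is said to exist (to be well defined) if for every monomial the series that expresses its coefficient as a sum of products of the coefficients of the factors converges with a sum independent of the ordering of its terms. The symbol $\frac1{1-x}$ denotes the series $\sum_{n\ge0}x^n$. Let $F_{mn}(z)=\sum_{r\in\mathbb Z}F_{mn,r}z^r$, $1\le m,n\le l$, be series such that $$(z-q^{b_{mn}})\,F_{nm}(z^{-1})=(q^{b_{mn}}z-1)\,F_{mn}(z)\qquad\text{for all } m,n \text{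 with } a_{mn}\neq0. \tag{1}$$ Let $i\neq j$ and put $N=1-a_{ij}$; if $a_{ij}=0$, assume that the equation in (1) also holds for $(m,n)=(i,j)$. Put $$P_{ij}=\sum_{\pi\in S_N}\sum_{k=0}^{N}(-1)^k\begin{bmatrix}N\\ k\end{bmatrix}_{q_i}\ \prod_{p<r}F_{ii}\!\left(\frac{z_{\pi(r)}}{z_{\pi(p)}}\right)\prod_{r=1}^{k}F_{ji}\!\left(\frac{w}{z_{\pi(r)}}\right)\prod_{s=k+1}^{N}F_{ij}\!\left(\frac{z_{\pi(s)}}{w}\right),$$ and suppose that for all $\pi$ and $k$ the product of series in the corresponding term of $P_{ij}$ exists, and that the product of the three series $$\prod_{p\neq r}\frac{1}{1-q^{b_{ii}}\,z_r/z_p}\ \cdot\ \prod_{s=1}^{N}\frac{1}{1-q^{b_{ij}}\,z_s/w}\ \cdot\ P_{ij}$$ exists (indices $p,r,s$ run over $1,\dots,N$). Then $P_{ij}=0$ as a formal power series in $z_1,\dots,z_N,w$. -/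

import Mathlib

open scoped BigOperators

noncomputable section

namespace SerreSeries

/-- `a` is a generalized Cartan matrix and the coprime positive integers `d` make `d i * a i j`
symmetric. -/
structure IsSymmetrizedGCM {l : ℕ} (a : Fin l → Fin l → ℤ) (d : Fin l → ℕ) : Prop where
  diag : ∀ i, a i i = 2
  nonpos : ∀ i j, i ≠ j → a i j ≤ 0
  zero_symm : ∀ i j, a i j = 0 → a j i = 0
  d_pos : ∀ i, 0 < d i
  d_coprime : Finset.univ.gcd d = 1
  symm : ∀ i j, (d i : ℤ) * a i j = (d j : ℤ) * a j i

/-- The symmetrized matrix `b i j = d i * a i j`. -/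
def symmetrized {l : ℕ} (a : Fin l → Fin l → ℤ) (d : Fin l → ℕ) (i j : Fin l) : ℤ :=
  (d i : ℤ) * a i j

/-- The number `[n]_t = (t ^ n - t ^ (-n)) / (t - t ^ (-1))`. -/
def qNumber (t : ℂ) (n : ℕ) : ℂ := (t ^ n - (t ^ n)⁻¹) / (t - t⁻¹)

/-- The factorial `[n]_t! = [n]_t ⋯ [1]_t`. -/
def qFactorial (t : ℂ) (n : ℕ) : ℂ := ∏ r ∈ Finset.range n, qNumber t (r + 1)

/-- The binomial coefficient `[m]_t! / ([k]_t! [m - k]_t!)`, used for `k ≤ m` only. -/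
def qBinomial (t : ℂ) (m k : ℕ) : ℂ :=
  qFactorial t m / (qFactorial t k * qFactorial t (m - k))

/-- Formal power series in one variable, infinite in both directions: `f n` is the coefficient
of `z ^ n`. -/
abbrev BiSeries : Type := ℤ → ℂ

/-- The series `f (z⁻¹)`. -/
def BiSeries.inv (f : BiSeries) : BiSeries := fun n => f (-n)

/-- The product `(α z + β) f(z)`. -/
def BiSeries.linMul (α β : ℂ) (f : BiSeries) : BiSeries := fun n => α * f (n - 1) + β * f n

/-- The geometric series `1 / (1 - c z) = ∑ n ≥ 0, c ^ n z ^ n`. -/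
def BiSeries.geom (c : ℂ) : BiSeries := fun n => if 0 ≤ n then c ^ n.toNat else 0

/-- Formal power series in variables `x s`, `s : σ`, infinite in all directions: `f μ` is the
coefficient of the monomial `∏ s, x s ^ μ s`. -/
abbrev FPS (σ : Type) : Type := (σ → ℤ) → ℂ

section Series

variable {σ : Type} [DecidableEq σ] [Fintype σ]

/-- The series `f (x s / x t)` for `s ≠ t`: the monomial `(x s / x t) ^ n` has coefficient `f n`,
and all other monomials have coefficient zero. -/
def ratioSubst (f : BiSeries) (s t : σ) : FPS σ := fun μ =>
  if μ = μ s • (Pi.single s 1 - Pi.single t 1 : σ → ℤ) then f (μ s) else 0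

/-- The product of a finite family of series exists: for every monomial `μ` the series
`∑ ∏ k, f k (ν k)` over all families of exponents `ν` with `∑ k, ν k = μ` converges
independently of the ordering of its terms. -/
def ProductExists {κ : Type} [Fintype κ] (f : κ → FPS σ) : Prop :=
  ∀ μ : σ → ℤ, Summable fun ν : {ν : κ → σ → ℤ // ∑ k, ν k = μ} => ∏ k, f k (ν.1 k)

/-- The product of a finite family of series (meaningful when it exists). -/
def product {κ : Type} [Fintype κ] (f : κ → FPS σ) : FPS σ := fun μ =>
  ∑' ν : {ν : κ → σ → ℤ // ∑ k, ν k = μ}, ∏ k, f k (ν.1 k)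

end Series

/-- The formal variables: `z 1, …, z N` (as `some s`) and `w` (as `none`). -/
abbrev Vars (N : ℕ) : Type := Option (Fin N)

/-- The pairs `p < q` in `{1, …, N}`. -/
abbrev LtPairs (N : ℕ) : Type := {x : Fin N × Fin N // x.1 < x.2}

/-- The pairs `p ≠ q` in `{1, …, N}`. -/
abbrev NePairs (N : ℕ) : Type := {x : Fin N × Fin N // x.1 ≠ x.2}

/-- The factors of
`∏_{p<q} Fii (z_{π q} / z_{π p}) ∏_{r ≤ k} Fji (w / z_{π r}) ∏_{s > k} Fij (z_{π s} / w)`.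
The positions `1, …, N` are numbered from zero here, so that the first `k` ones are those
with `r.val < k`. -/
def termFactors {N : ℕ} (Fii Fij Fji : BiSeries) (π : Equiv.Perm (Fin N)) (k : ℕ) :
    LtPairs N ⊕ Fin N → FPS (Vars N)
  | Sum.inl x => ratioSubst Fii (some (π x.1.2)) (some (π x.1.1))
  | Sum.inr r =>
      if r.val < k then ratioSubst Fji none (some (π r))
      else ratioSubst Fij (some (π r)) none

/-- The symmetrized Serre expression
`∑_π ∑_{k = 0}^{N} (-1)^k [N choose k]_t ∏ Fii ∏ Fji ∏ Fij`. -/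
def serreSum (N : ℕ) (t : ℂ) (Fii Fij Fji : BiSeries) : FPS (Vars N) :=
  ∑ π : Equiv.Perm (Fin N), ∑ k ∈ Finset.range (N + 1),
    ((-1) ^ k * qBinomial t N k) • product (termFactors Fii Fij Fji π k)

/-- The series `∏_{p ≠ q} 1 / (1 - c z_q / z_p)`. -/
def geomZZ (N : ℕ) (c : ℂ) : FPS (Vars N) :=
  product fun x : NePairs N => ratioSubst (BiSeries.geom c) (some x.1.2) (some x.1.1)

/-- The series `∏_s 1 / (1 - c z_s / w)`. -/
def geomZW (N : ℕ) (c : ℂ) : FPS (Vars N) :=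
  product fun s : Fin N => ratioSubst (BiSeries.geom c) (some s) none

end SerreSeries

end

/-! Write t = q_i, n = N - 1, c = q^{b_ii} = t^2 and b = q^{b_ij} = t^{-n}. Relation (1) turns F(x)
into F(x^{-1}) at the price of linear factors. Hence, after multiplication by D = ∏_{p≠r}(z_p - c
z_r) ∏_s (w - b z_s), every product in P_ij becomes a polynomial times one and the same series, the
product for π = 1, k = N (`act_denominator_product_termFactors`). So D·P_ij is that series
multiplied by ∏_{p<r}(z_p - c z_r) and by the sum over π and k of (-1)^k [N choose k]_t sgn(π)
∏_{p<r}(z_{π(r)} - c z_{π(p)}) ∏_{r≤k}(w - b z_{π(r)}) ∏_{s>k}(b w - z_{π(s)}).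

This last polynomial is zero (`sum_sign_mul_qVandermonde_mul_eq_zero`). Expand the products
containing w over the set I of positions that contribute a z. The antisymmetrization of ∏_{p<r}(z_r
- c z_p) ∏_{i∈I} z_i depends only on |I|, up to an explicit power of c (`exists_antisymmProd_eq`),
so everything reduces to an identity in one variable, which follows from the q-binomial theorem
(`sum_qBinomial_mul_prod_eq_zero`).

Thus D·P_ij = 0. This alone does not give P_ij = 0, because series infinite in both directions have
torsion: 1 - z kills ∑ z^n. Here the existence of the triple product is essential. Multiplied by D,
it equals a monomial times P_ij if D is absorbed by the geometric series, and 0 if D is absorbed by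
P_ij (`eq_zero_of_act_denominator_eq_zero`). -/

open scoped BigOperators

noncomputable section

namespace SerreSeries

/-! ### q-binomial coefficients and the one-variable identity -/

section QBinomial

variable {t : ℂ}

lemma sub_inv_ne_zero_of_pow_ne_one (ht0 : t ≠ 0) (ht : ∀ n : ℕ, 0 < n → t ^ n ≠ 1) {n : ℕ}
    (hn : 0 < n) : t ^ n - (t ^ n)⁻¹ ≠ 0 := by
  intro h
  have h0 : t ^ n ≠ 0 := pow_ne_zero _ ht0
  apply ht (n + n) (by omega)
  rw [pow_add]
  nth_rewrite 1 [sub_eq_zero.mp h]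
  exact inv_mul_cancel₀ h0

lemma qNumber_ne_zero (ht0 : t ≠ 0) (ht : ∀ n : ℕ, 0 < n → t ^ n ≠ 1) {n : ℕ} (hn : 0 < n) :
    qNumber t n ≠ 0 :=
  div_ne_zero (sub_inv_ne_zero_of_pow_ne_one ht0 ht hn)
    (by simpa using sub_inv_ne_zero_of_pow_ne_one ht0 ht one_pos)

lemma qFactorial_ne_zero (ht0 : t ≠ 0) (ht : ∀ n : ℕ, 0 < n → t ^ n ≠ 1) (n : ℕ) :
    qFactorial t n ≠ 0 :=
  Finset.prod_ne_zero_iff.mpr fun _ _ => qNumber_ne_zero ht0 ht (Nat.succ_pos _)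

lemma qFactorial_succ (t : ℂ) (n : ℕ) :
    qFactorial t (n + 1) = qFactorial t n * qNumber t (n + 1) :=
  Finset.prod_range_succ _ _

lemma qFactorial_zero (t : ℂ) : qFactorial t 0 = 1 := Finset.prod_range_zero _

lemma qBinomial_zero_right (ht0 : t ≠ 0) (ht : ∀ n : ℕ, 0 < n → t ^ n ≠ 1) (n : ℕ) :
    qBinomial t n 0 = 1 := by
  simp [qBinomial, qFactorial_zero, qFactorial_ne_zero ht0 ht n]

lemma qBinomial_self (ht0 : t ≠ 0) (ht : ∀ n : ℕ, 0 < n → t ^ n ≠ 1) (n : ℕ) :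
    qBinomial t n n = 1 := by
  simp [qBinomial, qFactorial_zero, qFactorial_ne_zero ht0 ht n]

lemma qNumber_add (ht0 : t ≠ 0) (m n : ℕ) :
    qNumber t (m + n) = (t ^ n)⁻¹ * qNumber t m + t ^ m * qNumber t n := by
  have hm : t ^ m ≠ 0 := pow_ne_zero _ ht0
  have hn : t ^ n ≠ 0 := pow_ne_zero _ ht0
  simp only [qNumber, ← mul_div_assoc, ← add_div]
  congr 1
  rw [pow_add]
  field_simp
  ring

/-- The `q`-Pascal rule. -/
lemma qBinomial_succ_succ (ht0 : t ≠ 0) (ht : ∀ n : ℕ, 0 < n → t ^ n ≠ 1) {n k : ℕ}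
    (hk : k < n) :
    qBinomial t (n + 1) (k + 1) =
      (t ^ (k + 1))⁻¹ * qBinomial t n (k + 1) + t ^ (n - k) * qBinomial t n k := by
  obtain ⟨m, rfl⟩ : ∃ m, n = k + m + 1 := ⟨n - k - 1, by omega⟩
  have e1 : k + m + 1 + 1 - (k + 1) = m + 1 := by omega
  have e2 : k + m + 1 - (k + 1) = m := by omega
  have e3 : k + m + 1 - k = m + 1 := by omega
  have h := qNumber_add ht0 (m + 1) (k + 1)
  rw [show m + 1 + (k + 1) = k + m + 1 + 1 by ring] at h
  have f1 := qFactorial_ne_zero ht0 ht k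
  have f2 := qFactorial_ne_zero ht0 ht m
  have f3 := qNumber_ne_zero ht0 ht (Nat.succ_pos k)
  have f4 := qNumber_ne_zero ht0 ht (Nat.succ_pos m)
  simp only [Nat.succ_eq_add_one] at f3 f4
  simp only [qBinomial, e1, e2, e3]
  rw [qFactorial_succ t (k + m + 1), h, qFactorial_succ t k, qFactorial_succ t m]
  generalize (t ^ (k + 1))⁻¹ = u
  field_simp

/-- The `q`-binomial theorem. -/
theorem sum_qBinomial_mul_pow (ht0 : t ≠ 0) (ht : ∀ n : ℕ, 0 < n → t ^ n ≠ 1) (n : ℕ) (x : ℂ) :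
    ∑ k ∈ Finset.range (n + 1),
        (-1) ^ k * qBinomial t n k * (t ^ ((k : ℤ) * ((n : ℤ) - 1)) * x ^ k) =
      ∏ i ∈ Finset.range n, (1 - t ^ (2 * i) * x) := by
  induction n with
  | zero => simp [qBinomial_self ht0 ht]
  | succ n ih =>
    rw [Finset.prod_range_succ, ← ih, Finset.sum_range_succ, Finset.sum_range_succ',
      qBinomial_self ht0 ht, qBinomial_zero_right ht0 ht]
    -- The sum for `n` is split in two ways, at its first and at its last term, to match the two
    -- halves of the Pascal rule: one is shifted by one, the other carries the new factor t^{2n} x.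
    have hA := Finset.sum_range_succ' (fun k => (-1) ^ k * qBinomial t n k *
      (t ^ ((k : ℤ) * ((n : ℤ) - 1)) * x ^ k)) n
    have hB := Finset.sum_range_succ (fun k => (-1) ^ k * qBinomial t n k *
      (t ^ ((k : ℤ) * ((n : ℤ) - 1)) * x ^ k)) n
    simp only [qBinomial_self ht0 ht, qBinomial_zero_right ht0 ht] at hA hB
    have hterm : ∀ k ∈ Finset.range n,
        (-1) ^ (k + 1) * qBinomial t (n + 1) (k + 1) *
            (t ^ (((k + 1 : ℕ) : ℤ) * (((n + 1 : ℕ) : ℤ) - 1)) * x ^ (k + 1)) =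
          (-1) ^ (k + 1) * qBinomial t n (k + 1) *
              (t ^ (((k + 1 : ℕ) : ℤ) * ((n : ℤ) - 1)) * x ^ (k + 1)) -
            (-1) ^ k * qBinomial t n k * (t ^ ((k : ℤ) * ((n : ℤ) - 1)) * x ^ k) *
              (t ^ (2 * n) * x) := by
      intro k hk
      have hkn := Finset.mem_range.mp hk
      rw [qBinomial_succ_succ ht0 ht hkn]
      have h1 : (t ^ (k + 1))⁻¹ * t ^ (((k + 1 : ℕ) : ℤ) * (((n + 1 : ℕ) : ℤ) - 1)) =
          t ^ (((k + 1 : ℕ) : ℤ) * ((n : ℤ) - 1)) := by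
        rw [← zpow_natCast, ← zpow_neg, ← zpow_add₀ ht0]
        congr 1; push_cast; ring
      have h2 : t ^ (n - k) * t ^ (((k + 1 : ℕ) : ℤ) * (((n + 1 : ℕ) : ℤ) - 1)) =
          t ^ ((k : ℤ) * ((n : ℤ) - 1)) * t ^ (2 * n) := by
        rw [← zpow_natCast, ← zpow_natCast, ← zpow_add₀ ht0, ← zpow_add₀ ht0]
        congr 1; push_cast [Nat.cast_sub hkn.le]; ring
      linear_combination (-1) ^ (k + 1) * qBinomial t n (k + 1) * x ^ (k + 1) * h1 +
        (-1) ^ (k + 1) * qBinomial t n k * x ^ (k + 1) * h2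
    rw [Finset.sum_congr rfl hterm, Finset.sum_sub_distrib, ← Finset.sum_mul]
    have h3 : t ^ (((n + 1 : ℕ) : ℤ) * (((n + 1 : ℕ) : ℤ) - 1)) =
        t ^ ((n : ℤ) * ((n : ℤ) - 1)) * t ^ (2 * n) := by
      rw [← zpow_natCast, ← zpow_add₀ ht0]
      congr 1; push_cast; ring
    rw [h3]
    simp only [Nat.cast_zero, zero_mul, zpow_zero, pow_zero, mul_one] at hA ⊢
    linear_combination t ^ (2 * n) * x * hB - hA

/-- The q-binomial theorem at x = t^{-2m}: the factor with i = m vanishes. -/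
lemma sum_qBinomial_eq_zero (ht0 : t ≠ 0) (ht : ∀ n : ℕ, 0 < n → t ^ n ≠ 1) {n m : ℕ}
    (hm : m < n) :
    ∑ k ∈ Finset.range (n + 1), (-1) ^ k * qBinomial t n k *
      t ^ ((k : ℤ) * ((n : ℤ) - 1 - 2 * m)) = 0 := by
  rw [← Finset.prod_eq_zero (f := fun i => 1 - t ^ (2 * i) * t ^ (-(2 * m : ℤ)))
    (Finset.mem_range.mpr hm) ?_, ← sum_qBinomial_mul_pow ht0 ht]
  · refine Finset.sum_congr rfl fun k _ => ?_
    rw [← zpow_natCast (t ^ _), ← zpow_mul, ← zpow_add₀ ht0]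
    congr 2; ring
  · rw [← zpow_natCast, ← zpow_add₀ ht0]
    simp

/-- Up to powers of t, the factors are 1 - t^e x. The positions r ≥ k give e = 3n-2k, ..., n+2, n
and the positions r < k give e = n, n-2, ..., n-2k+2. With one copy of e = n set aside, the two
progressions join into a single one of length n, which depends on k only through a shift. -/
lemma prod_ite_lt_eq (ht0 : t ≠ 0) (n k : ℕ) (hk : k ≤ n + 1) (x : ℂ) :
    ∏ r ∈ Finset.range (n + 1),
        (if r < k then 1 - t ^ (-(n : ℤ)) * t ^ (2 * ((n : ℤ) - r)) * x
          else t ^ (-(n : ℤ)) - t ^ (2 * ((n : ℤ) - r)) * x) =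
      (1 - t ^ (n : ℤ) * x) * (t ^ (-(n : ℤ))) ^ (n + 1 - k) *
        ∏ l ∈ Finset.range n, (1 - t ^ (3 * (n : ℤ) - 2 * k - 2 * l) * x) := by
  have hlow : ∀ r : ℕ, 1 - t ^ (-(n : ℤ)) * t ^ (2 * ((n : ℤ) - r)) * x =
      1 - t ^ ((n : ℤ) - 2 * r) * x := by
    intro r
    rw [← zpow_add₀ ht0]
    congr 3; ring
  have hhigh : ∀ i : ℕ, t ^ (-(n : ℤ)) - t ^ (2 * ((n : ℤ) - (k + i : ℕ))) * x =
      t ^ (-(n : ℤ)) * (1 - t ^ (3 * (n : ℤ) - 2 * k - 2 * i) * x) := by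
    intro i
    rw [mul_sub (t ^ (-(n : ℤ))), mul_one, ← mul_assoc, ← zpow_add₀ ht0]
    congr 3; push_cast; ring
  obtain ⟨m, hm⟩ : ∃ m, n + 1 = k + m := ⟨n + 1 - k, by omega⟩
  have hsub : n + 1 - k = m := by omega
  rw [hsub, hm, Finset.prod_range_add]
  have h1 : ∏ r ∈ Finset.range k, (if r < k then 1 - t ^ (-(n : ℤ)) * t ^ (2 * ((n : ℤ) - r)) * x
          else t ^ (-(n : ℤ)) - t ^ (2 * ((n : ℤ) - r)) * x) =
      ∏ r ∈ Finset.range k, (1 - t ^ ((n : ℤ) - 2 * r) * x) :=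
    Finset.prod_congr rfl fun r hr => by rw [if_pos (Finset.mem_range.mp hr), hlow]
  have h2 : ∏ i ∈ Finset.range m, (if k + i < k
          then 1 - t ^ (-(n : ℤ)) * t ^ (2 * ((n : ℤ) - (k + i : ℕ))) * x
          else t ^ (-(n : ℤ)) - t ^ (2 * ((n : ℤ) - (k + i : ℕ))) * x) =
      (t ^ (-(n : ℤ))) ^ m *
        ∏ i ∈ Finset.range m, (1 - t ^ (3 * (n : ℤ) - 2 * k - 2 * i) * x) := by
    rw [Finset.prod_congr rfl fun i _ => by rw [if_neg (show ¬ k + i < k by omega), hhigh],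
      Finset.prod_mul_distrib, Finset.prod_const, Finset.card_range]
  rw [h1, h2]
  rcases m with _ | m
  · have hk' : k = n + 1 := by omega
    subst hk'
    rw [Finset.prod_range_succ']
    have : ∀ l : ℕ, (n : ℤ) - 2 * (l + 1 : ℕ) = 3 * n - 2 * (n + 1 : ℕ) - 2 * l := by
      intro l; push_cast; ring
    simp only [this]
    simp
    ring
  · have hn : n = m + k := by omega
    rw [Finset.prod_range_succ]
    have e : 3 * (n : ℤ) - 2 * k - 2 * m = n := by subst hn; push_cast; ring
    have hr : Finset.range n = Finset.range (m + k) := by rw [hn]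
    rw [e, hr, Finset.prod_range_add]
    have : ∀ l : ℕ, 3 * (n : ℤ) - 2 * k - 2 * (m + l : ℕ) = n - 2 * l := by
      intro l; push_cast; linear_combination e
    simp only [this]
    ring

lemma sum_qBinomial_mul_prod_eq_zero (ht0 : t ≠ 0) (ht : ∀ n : ℕ, 0 < n → t ^ n ≠ 1) (n : ℕ)
    (x : ℂ) :
    ∑ k ∈ Finset.range (n + 2), (-1) ^ k * qBinomial t (n + 1) k *
      ∏ r ∈ Finset.range (n + 1),
        (if r < k then 1 - t ^ (-(n : ℤ)) * t ^ (2 * ((n : ℤ) - r)) * x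
          else t ^ (-(n : ℤ)) - t ^ (2 * ((n : ℤ) - r)) * x) = 0 := by
  -- The shift by k is moved into the argument t^{-2k} x, so `g` does not depend on k. Its degree is
  -- at most n, so only the exponents t^{k(N-1-2m)} with m < N occur, and each of the corresponding
  -- sums over k vanishes.
  let g : Polynomial ℂ := ∏ l ∈ Finset.range n,
    (1 - Polynomial.C (t ^ (3 * (n : ℤ) - 2 * l)) * Polynomial.X)
  have hdeg : g.natDegree < n + 1 := by
    refine Nat.lt_succ_of_le ((Polynomial.natDegree_prod_le _ _).trans ?_)
    refine (Finset.sum_le_card_nsmul _ _ 1 fun l _ => ?_).trans (by simp)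
    compute_degree
  have hg : ∀ k : ℕ, ∏ l ∈ Finset.range n, (1 - t ^ (3 * (n : ℤ) - 2 * k - 2 * l) * x) =
      ∑ m ∈ Finset.range (n + 1), g.coeff m * (t ^ (-(2 * k : ℤ)) * x) ^ m := by
    intro k
    rw [← Polynomial.eval_eq_sum_range' hdeg, Polynomial.eval_prod]
    refine Finset.prod_congr rfl fun l _ => ?_
    simp only [Polynomial.eval_sub, Polynomial.eval_one, Polynomial.eval_mul, Polynomial.eval_C,
      Polynomial.eval_X]
    rw [← mul_assoc, ← zpow_add₀ ht0]
    congr 3; ring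
  have hterm : ∀ k ∈ Finset.range (n + 2), (-1) ^ k * qBinomial t (n + 1) k *
      ∏ r ∈ Finset.range (n + 1),
        (if r < k then 1 - t ^ (-(n : ℤ)) * t ^ (2 * ((n : ℤ) - r)) * x
          else t ^ (-(n : ℤ)) - t ^ (2 * ((n : ℤ) - r)) * x) =
      ∑ m ∈ Finset.range (n + 1), (1 - t ^ (n : ℤ) * x) * t ^ (-(n : ℤ) * (n + 1)) *
        (g.coeff m * x ^ m) * ((-1) ^ k * qBinomial t (n + 1) k *
          t ^ ((k : ℤ) * (((n + 1 : ℕ) : ℤ) - 1 - 2 * m))) := by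
    intro k hk
    have hk' : k ≤ n + 1 := by have := Finset.mem_range.mp hk; omega
    rw [prod_ite_lt_eq ht0 n k hk', hg, Finset.mul_sum, Finset.mul_sum]
    refine Finset.sum_congr rfl fun m _ => ?_
    have h1 : (t ^ (-(n : ℤ))) ^ (n + 1 - k) * (t ^ (-(2 * k : ℤ))) ^ m =
        t ^ (-(n : ℤ) * (n + 1)) * t ^ ((k : ℤ) * (((n + 1 : ℕ) : ℤ) - 1 - 2 * m)) := by
      rw [← zpow_natCast, ← zpow_natCast, ← zpow_mul, ← zpow_mul, ← zpow_add₀ ht0,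
        ← zpow_add₀ ht0]
      congr 1; push_cast [Nat.cast_sub hk']; ring
    rw [mul_pow]
    linear_combination (-1) ^ k * qBinomial t (n + 1) k * (1 - t ^ (n : ℤ) * x) *
      (g.coeff m * x ^ m) * h1
  rw [Finset.sum_congr rfl hterm, Finset.sum_comm]
  refine Finset.sum_eq_zero fun m hm => ?_
  rw [← Finset.mul_sum, sum_qBinomial_eq_zero ht0 ht (Finset.mem_range.mp hm), mul_zero]

end QBinomial

/-! ### Antisymmetrization of the deformed Vandermonde product -/

section Antisymmetrization

open Equiv

variable {R : Type*} [CommRing R]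

/-- The product of `z r - c * z p` over the pairs `p < r`. -/
def qVandermonde {N : ℕ} (c : R) (z : Fin N → R) : R :=
  ∏ x : LtPairs N, (z x.1.2 - c * z x.1.1)

/-- The antisymmetrization of `qVandermonde c z * ∏ i ∈ I, z i`. -/
def antisymmProd {N : ℕ} (c : R) (z : Fin N → R) (I : Finset (Fin N)) : R :=
  ∑ π : Perm (Fin N), ((Perm.sign π : ℤ) : R) * (qVandermonde c (z ∘ π) * ∏ i ∈ I, z (π i))

/-- The part of `qVandermonde c z` without the factor of the adjacent pair `r, r + 1`. -/
def qVandermondeErase {n : ℕ} (c : R) (z : Fin (n + 1) → R) (r : Fin n) : R :=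
  ∏ x ∈ Finset.univ.filter fun x : Fin (n + 1) × Fin (n + 1) =>
    x.1 < x.2 ∧ x ≠ (r.castSucc, r.succ), (z x.2 - c * z x.1)

lemma qVandermonde_eq_mul {n : ℕ} (c : R) (z : Fin (n + 1) → R) (r : Fin n) :
    qVandermonde c z = (z r.succ - c * z r.castSucc) * qVandermondeErase c z r := by
  have h : qVandermonde c z = ∏ x ∈ Finset.univ.filter
      fun x : Fin (n + 1) × Fin (n + 1) => x.1 < x.2, (z x.2 - c * z x.1) :=
    (Finset.prod_subtype _ (by simp) fun x : Fin (n + 1) × Fin (n + 1) =>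
      (z x.2 - c * z x.1)).symm
  rw [h, qVandermondeErase, ← Finset.mul_prod_erase _ _
    (show (r.castSucc, r.succ) ∈ _ by simp)]
  congr 2
  ext x
  simp [and_comm]

/-- An adjacent transposition inverts no pair other than its own. -/
lemma swap_adjacent_lt {n : ℕ} (r : Fin n) {a b : Fin (n + 1)} (hab : a < b)
    (hne : (a, b) ≠ (r.castSucc, r.succ)) :
    swap r.castSucc r.succ a < swap r.castSucc r.succ b ∧
      (swap r.castSucc r.succ a, swap r.castSucc r.succ b) ≠ (r.castSucc, r.succ) := by
  simp only [swap_apply_def, ne_eq, Prod.mk.injEq, Fin.lt_def, Fin.ext_iff, Fin.val_castSucc,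
    Fin.val_succ] at hab hne ⊢
  split_ifs <;> simp <;> omega

lemma qVandermondeErase_comp_swap {n : ℕ} (c : R) (z : Fin (n + 1) → R) (r : Fin n) :
    qVandermondeErase c (z ∘ swap r.castSucc r.succ) r = qVandermondeErase c z r := by
  refine Finset.prod_nbij' (fun x => (swap r.castSucc r.succ x.1, swap r.castSucc r.succ x.2))
    (fun x => (swap r.castSucc r.succ x.1, swap r.castSucc r.succ x.2)) ?_ ?_ ?_ ?_ ?_
  · intro x hx
    simp only [Finset.mem_filter, Finset.mem_univ, true_and] at hx ⊢
    exact swap_adjacent_lt r hx.1 hx.2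
  · intro x hx
    simp only [Finset.mem_filter, Finset.mem_univ, true_and] at hx ⊢
    exact swap_adjacent_lt r hx.1 hx.2
  · intro x _; simp
  · intro x _; simp
  · intro x _; rfl

/-- In the difference of the two sides, the summand is the sign times (z_{r+1} - c z_r)(z_r - c
z_{r+1}) times factors unchanged by the exchange of positions r and r + 1. All of it but the sign is
symmetric under this exchange, so the terms of π and of π composed with the transposition cancel. -/
lemma antisymmProd_insert {n : ℕ} (c : R) (z : Fin (n + 1) → R) (r : Fin n)
    (I : Finset (Fin (n + 1))) (h1 : r.castSucc ∉ I) (h2 : r.succ ∉ I) :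
    antisymmProd c z (insert r.castSucc I) = c * antisymmProd c z (insert r.succ I) := by
  rw [← sub_eq_zero, antisymmProd, antisymmProd, Finset.mul_sum, ← Finset.sum_sub_distrib]
  have hne : r.castSucc ≠ r.succ := Fin.castSucc_lt_succ.ne
  refine Finset.sum_involution (fun π _ => π * swap r.castSucc r.succ) ?_ ?_
    (fun _ _ => Finset.mem_univ _) (fun π _ => by simp [mul_assoc])
  · intro π _
    have e1 : qVandermondeErase c (z ∘ (π * swap r.castSucc r.succ)) r =
        qVandermondeErase c (z ∘ π) r :=
      qVandermondeErase_comp_swap c (z ∘ π) r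
    have e2 : ∏ i ∈ I, z (π (swap r.castSucc r.succ i)) = ∏ i ∈ I, z (π i) :=
      Finset.prod_congr rfl fun i hi => by
        rw [swap_apply_of_ne_of_ne] <;> rintro rfl <;> contradiction
    simp only [qVandermonde_eq_mul _ _ r, e1, Finset.prod_insert h1, Finset.prod_insert h2, e2,
      Perm.sign_mul, Perm.sign_swap hne, Function.comp_apply, Perm.mul_apply, swap_apply_left,
      swap_apply_right]
    push_cast
    ring
  · intro π _ _ h
    exact hne ((swap_eq_one_iff).mp (mul_eq_left.mp h))

end Antisymmetrization

/-! ### The polynomial identity -/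

section Identity

open Equiv

variable {R : Type*} [CommRing R] [Algebra ℂ R] {n : ℕ}

lemma exists_perm_map_eq {α : Type*} [Fintype α] [DecidableEq α] {I J : Finset α}
    (h : I.card = J.card) : ∃ π : Perm α, I.map π.toEmbedding = J := by
  refine ⟨(Finset.equivOfCardEq h).extendSubtype, ?_⟩
  refine Finset.eq_of_subset_of_card_le (fun x hx => ?_) (by simp [h])
  obtain ⟨y, hy, rfl⟩ := Finset.mem_map.mp hx
  exact (Finset.equivOfCardEq h).extendSubtype_mem y hy

/-- The antisymmetrization of `qVandermonde c z * ∏ i ∈ I, z i` depends on `I` through its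
cardinality only, up to a power of `c`. -/
lemma exists_antisymmProd_eq (c : ℂ) (hc : c ≠ 0) (z : Fin (n + 1) → R) :
    ∃ G : ℕ → R, ∀ I : Finset (Fin (n + 1)), antisymmProd (algebraMap ℂ R c) z I =
      algebraMap ℂ R (∏ i ∈ I, c ^ ((n : ℤ) - i)) * G I.card := by
  -- Moving an element of `I` from r to r + 1 divides the antisymmetrization by c, and the weight
  -- c^{n-i} compensates exactly for this. The normalized `h` is therefore invariant under adjacent
  -- transpositions, hence under all permutations, and depends on the cardinality alone.
  let h : Finset (Fin (n + 1)) → R := fun I =>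
    algebraMap ℂ R (∏ i ∈ I, (c ^ ((n : ℤ) - i))⁻¹) * antisymmProd (algebraMap ℂ R c) z I
  have hins : ∀ (r : Fin n) (I : Finset (Fin (n + 1))), r.castSucc ∉ I → r.succ ∉ I →
      h (insert r.castSucc I) = h (insert r.succ I) := by
    intro r I h1 h2
    simp only [h, antisymmProd_insert _ z r I h1 h2, Finset.prod_insert h1,
      Finset.prod_insert h2, ← mul_assoc, ← map_mul]
    congr 2
    have : c ^ ((n : ℤ) - (r.castSucc : ℕ)) = c ^ ((n : ℤ) - (r.succ : ℕ)) * c := by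
      rw [← zpow_add_one₀ hc]
      congr 1; simp only [Fin.val_castSucc, Fin.val_succ]; push_cast; ring
    rw [this]
    have := zpow_ne_zero ((n : ℤ) - (r.succ : ℕ)) hc
    field_simp
  have hswap : ∀ (r : Fin n) (I : Finset (Fin (n + 1))),
      h (I.map (swap r.castSucc r.succ).toEmbedding) = h I := by
    intro r I
    have hne : r.castSucc ≠ r.succ := Fin.castSucc_lt_succ.ne
    have hmap : ∀ J : Finset (Fin (n + 1)), r.castSucc ∉ J → r.succ ∉ J →
        J.map (swap r.castSucc r.succ).toEmbedding = J := by
      intro J h1 h2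
      rw [Finset.map_eq_image]
      refine (Finset.image_congr fun i hi => ?_).trans Finset.image_id
      simp only [Equiv.coe_toEmbedding, id_eq]
      rw [swap_apply_of_ne_of_ne] <;> rintro rfl <;> contradiction
    by_cases h1 : r.castSucc ∈ I <;> by_cases h2 : r.succ ∈ I
    · congr 1
      refine Finset.eq_of_subset_of_card_le (fun x hx => ?_) (by simp)
      obtain ⟨y, hy, rfl⟩ := Finset.mem_map.mp hx
      simp only [Equiv.coe_toEmbedding, swap_apply_def]
      split_ifs <;> assumption
    · have h2' : r.succ ∉ I.erase r.castSucc := by simp [h2]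
      have h1' : r.castSucc ∉ I.erase r.castSucc := by simp
      rw [← Finset.insert_erase h1, Finset.map_insert, hmap _ h1' h2', hins _ _ h1' h2']
      simp
    · have h2' : r.succ ∉ I.erase r.succ := by simp
      have h1' : r.castSucc ∉ I.erase r.succ := by simp [h1]
      rw [← Finset.insert_erase h2, Finset.map_insert, hmap _ h1' h2', ← hins _ _ h1' h2']
      simp
    · rw [hmap I h1 h2]
  have hperm : ∀ (π : Perm (Fin (n + 1))) (I : Finset (Fin (n + 1))),
      h (I.map π.toEmbedding) = h I := by
    intro π
    have hπ : π ∈ Submonoid.closure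
        (Set.range fun i : Fin n => swap i.castSucc i.succ) := by
      rw [Perm.mclosure_swap_castSucc_succ]; trivial
    induction hπ using Submonoid.closure_induction with
    | mem x hx => obtain ⟨r, rfl⟩ := hx; exact hswap r
    | one =>
      intro I
      congr 1
      exact Finset.map_refl
    | mul x y _ _ hx hy =>
      intro I
      rw [← hy I, ← hx (I.map y.toEmbedding), Finset.map_map]
      rfl
  have hcard : ∀ I J : Finset (Fin (n + 1)), I.card = J.card → h I = h J := by
    intro I J hIJ
    obtain ⟨π, rfl⟩ := exists_perm_map_eq hIJ
    exact (hperm π I).symm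
  classical
  refine ⟨fun m => if hm : ∃ J : Finset (Fin (n + 1)), J.card = m then h hm.choose else 0,
    fun I => ?_⟩
  have hm : ∃ J : Finset (Fin (n + 1)), J.card = I.card := ⟨I, rfl⟩
  beta_reduce
  rw [dif_pos hm, hcard _ I hm.choose_spec]
  simp only [h]
  rw [← mul_assoc, ← map_mul, ← Finset.prod_mul_distrib,
    Finset.prod_eq_one fun i _ => mul_inv_cancel₀ (zpow_ne_zero _ hc)]
  simp

/-- The identity of polynomials behind the Serre relations. -/
theorem sum_sign_mul_qVandermonde_mul_eq_zero {t : ℂ} (ht0 : t ≠ 0)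
    (ht : ∀ n : ℕ, 0 < n → t ^ n ≠ 1) (z : Fin (n + 1) → R) (w : R) :
    ∑ π : Perm (Fin (n + 1)), ∑ k ∈ Finset.range (n + 2),
      algebraMap ℂ R ((-1) ^ k * qBinomial t (n + 1) k) *
        (((Perm.sign π : ℤ) : R) * qVandermonde (algebraMap ℂ R (t ^ 2)) (z ∘ π) *
          ∏ r : Fin (n + 1), (if r.val < k then w - algebraMap ℂ R (t ^ (-(n : ℤ))) * z (π r)
            else algebraMap ℂ R (t ^ (-(n : ℤ))) * w - z (π r))) = 0 := by
  obtain ⟨G, hG⟩ := exists_antisymmProd_eq (t ^ 2) (pow_ne_zero 2 ht0) z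
  -- `α` and `β` are the coefficients of w and of z_{π(r)} in the factor at position r; `e` is the
  -- weight from the antisymmetrization. Replacing X^m by w^{n+1-m} `G m` then turns a product in
  -- one variable into the full antisymmetrized sum.
  let α : ℕ → Fin (n + 1) → ℂ := fun k r => if r.val < k then 1 else t ^ (-(n : ℤ))
  let β : ℕ → Fin (n + 1) → ℂ := fun k r => if r.val < k then -t ^ (-(n : ℤ)) else -1
  let e : Fin (n + 1) → ℂ := fun r => (t ^ 2) ^ ((n : ℤ) - r)
  let L : Polynomial ℂ →ₗ[ℂ] R :=
    Polynomial.lsum fun m => LinearMap.toSpanSingleton ℂ R (w ^ (n + 1 - m) * G m)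
  have hL : ∀ k, L (∏ r, (Polynomial.C (β k r * e r) * Polynomial.X + Polynomial.C (α k r))) =
      ∑ π : Perm (Fin (n + 1)),
        (((Perm.sign π : ℤ) : R) * qVandermonde (algebraMap ℂ R (t ^ 2)) (z ∘ π) *
          ∏ r : Fin (n + 1), (if r.val < k then w - algebraMap ℂ R (t ^ (-(n : ℤ))) * z (π r)
            else algebraMap ℂ R (t ^ (-(n : ℤ))) * w - z (π r))) := by
    intro k
    have h1 : ∀ (π : Perm (Fin (n + 1))) (r : Fin (n + 1)),
        (if r.val < k then w - algebraMap ℂ R (t ^ (-(n : ℤ))) * z (π r)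
            else algebraMap ℂ R (t ^ (-(n : ℤ))) * w - z (π r)) =
          algebraMap ℂ R (β k r) * z (π r) + algebraMap ℂ R (α k r) * w := by
      intro π r
      simp only [α, β]
      split_ifs <;> simp <;> ring
    simp only [h1, Finset.prod_add, Finset.mul_sum, map_sum]
    rw [Finset.sum_comm]
    refine Finset.sum_congr rfl fun I _ => ?_
    -- Both sides are expanded over subsets `I` and compared one subset at a time.
    have h2 : (∏ r ∈ I, (Polynomial.C (β k r * e r) * Polynomial.X)) *
        ∏ r ∈ Finset.univ \ I, Polynomial.C (α k r) =
        Polynomial.monomial I.card ((∏ r ∈ I, β k r * e r) * ∏ r ∈ Finset.univ \ I, α k r) := by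
      rw [Finset.prod_mul_distrib, Finset.prod_const, ← map_prod, ← map_prod,
        ← Polynomial.C_mul_X_pow_eq_monomial, Polynomial.C_mul]
      ring
    rw [h2]
    simp only [L, Polynomial.lsum_apply]
    rw [Polynomial.sum_monomial_index _ _ (by simp), LinearMap.toSpanSingleton_apply,
      Algebra.smul_def, Finset.prod_mul_distrib, map_mul, map_mul]
    have h3 := hG I
    have hcard : (Finset.univ \ I).card = n + 1 - I.card := by
      rw [Finset.card_univ_sdiff, Fintype.card_fin]
    have h4 : ∀ π : Perm (Fin (n + 1)),
        ((Perm.sign π : ℤ) : R) * qVandermonde (algebraMap ℂ R (t ^ 2)) (z ∘ π) *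
          ((∏ r ∈ I, algebraMap ℂ R (β k r) * z (π r)) *
            ∏ r ∈ Finset.univ \ I, algebraMap ℂ R (α k r) * w) =
        algebraMap ℂ R (∏ r ∈ I, β k r) * algebraMap ℂ R (∏ r ∈ Finset.univ \ I, α k r) *
          w ^ (n + 1 - I.card) * (((Perm.sign π : ℤ) : R) *
            (qVandermonde (algebraMap ℂ R (t ^ 2)) (z ∘ π) * ∏ i ∈ I, z (π i))) := by
      intro π
      rw [Finset.prod_mul_distrib, Finset.prod_mul_distrib, Finset.prod_const, hcard, map_prod,
        map_prod]
      ring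
    rw [Finset.sum_congr rfl fun π _ => h4 π, ← Finset.mul_sum]
    change _ = _ * antisymmProd _ z I
    rw [h3]
    ring
  have hpoly : ∑ k ∈ Finset.range (n + 2), ((-1) ^ k * qBinomial t (n + 1) k) •
      ∏ r, (Polynomial.C (β k r * e r) * Polynomial.X + Polynomial.C (α k r)) = 0 := by
    refine Polynomial.funext fun x => ?_
    rw [Polynomial.eval_finsetSum, Polynomial.eval_zero,
      ← sum_qBinomial_mul_prod_eq_zero ht0 ht n x]
    refine Finset.sum_congr rfl fun k _ => ?_
    rw [Polynomial.eval_smul, smul_eq_mul, Polynomial.eval_prod, Finset.prod_range]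
    congr 1
    refine Finset.prod_congr rfl fun r _ => ?_
    have he : e r = t ^ (2 * ((n : ℤ) - r)) := by
      simp only [e]
      rw [← zpow_natCast, ← zpow_mul]
      rfl
    simp only [Polynomial.eval_add, Polynomial.eval_mul, Polynomial.eval_C, Polynomial.eval_X, he,
      α, β]
    split_ifs <;> ring
  have := congrArg L hpoly
  rw [map_sum, map_zero] at this
  rw [Finset.sum_comm, ← this]
  refine Finset.sum_congr rfl fun k _ => ?_
  rw [map_smul, hL, Algebra.smul_def, Finset.mul_sum]

end Identity

/-! ### Laurent polynomials acting on series -/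

section Action

variable {σ : Type}

/-- Laurent polynomials in the variables `x s`, `s : σ`. -/
abbrev Laurent (σ : Type) : Type := AddMonoidAlgebra ℂ (σ → ℤ)

/-- Multiplication of series by monomials. -/
def shiftHom (σ : Type) : Multiplicative (σ → ℤ) →* Module.End ℂ (FPS σ) where
  toFun v :=
    { toFun := fun f μ => f (μ - v.toAdd)
      map_add' := fun _ _ => rfl
      map_smul' := fun _ _ => rfl }
  map_one' := by ext f μ; simp
  map_mul' u v := by ext f μ; simp [sub_sub]

/-- Multiplication of series by Laurent polynomials. -/
def act : Laurent σ →ₐ[ℂ] Module.End ℂ (FPS σ) :=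
  AddMonoidAlgebra.lift ℂ (Module.End ℂ (FPS σ)) (σ → ℤ) (shiftHom σ)

lemma act_single (v : σ → ℤ) (a : ℂ) (f : FPS σ) (μ : σ → ℤ) :
    act (AddMonoidAlgebra.single v a) f μ = a * f (μ - v) := by
  simp [act, AddMonoidAlgebra.lift_single, shiftHom]

lemma act_mul (p p' : Laurent σ) (f : FPS σ) : act (p * p') f = act p (act p' f) := by
  rw [map_mul, Module.End.mul_apply]

lemma act_algebraMap (a : ℂ) (f : FPS σ) : act (algebraMap ℂ (Laurent σ) a) f = a • f := by
  rw [AlgHom.commutes, Module.algebraMap_end_apply]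

lemma act_eq_zero_of_isUnit {p : Laurent σ} (hp : IsUnit p) {f : FPS σ} (h : act p f = 0) :
    f = 0 := by
  obtain ⟨u, rfl⟩ := hp
  have := congrArg (act (↑u⁻¹ : Laurent σ)) h
  rwa [← act_mul, Units.inv_mul, map_one, map_zero] at this

end Action

/-! ### Infinite products of series and their compatibility with the action -/

section HasProduct

variable {σ κ : Type} [Fintype κ]

/-- The product of the family `f` exists and is equal to `h`. -/
def HasProduct (f : κ → FPS σ) (h : FPS σ) : Prop :=
  ∀ μ : σ → ℤ, HasSum (fun ν : {ν : κ → σ → ℤ // ∑ k, ν k = μ} => ∏ k, f k (ν.1 k)) (h μ)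

lemma ProductExists.hasProduct [DecidableEq σ] [Fintype σ] {f : κ → FPS σ}
    (hf : ProductExists f) : HasProduct f (product f) :=
  fun μ => (hf μ).hasSum

lemma HasProduct.unique {f : κ → FPS σ} {h h' : FPS σ} (H : HasProduct f h)
    (H' : HasProduct f h') : h = h' :=
  funext fun μ => (H μ).unique (H' μ)

lemma HasProduct.comp_equiv {κ' : Type} [Fintype κ'] {f : κ' → FPS σ} {h : FPS σ}
    (H : HasProduct f h) (e : κ ≃ κ') : HasProduct (fun k => f (e k)) h := by
  intro μ
  let E : {ν : κ → σ → ℤ // ∑ k, ν k = μ} ≃ {ν : κ' → σ → ℤ // ∑ k, ν k = μ} :=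
    (e.arrowCongr (Equiv.refl _)).subtypeEquiv fun ν => by
      rw [← e.symm.sum_comp]
      rfl
  refine (E.hasSum_iff.mpr (H μ)).congr_fun fun ν => ?_
  rw [Function.comp_apply, ← e.prod_comp]
  refine Finset.prod_congr rfl fun k _ => ?_
  have h1 : (E ν).1 (e k) = ν.1 (e.symm (e k)) := rfl
  rw [h1, e.symm_apply_apply]

section Update

variable [DecidableEq κ]

lemma prod_update_apply (f : κ → FPS σ) (k₀ : κ) (g : FPS σ) (ν : κ → σ → ℤ) :
    ∏ k, Function.update f k₀ g k (ν k) =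
      g (ν k₀) * ∏ k ∈ Finset.univ.erase k₀, f k (ν k) := by
  rw [← Finset.mul_prod_erase _ _ (Finset.mem_univ k₀), Function.update_self]
  congr 1
  exact Finset.prod_congr rfl fun k hk => by rw [Function.update_of_ne (Finset.ne_of_mem_erase hk)]

/-- A monomial only translates the exponent of one factor, which is a bijection between the families
of exponents summing to μ and to μ - v. No rearrangement of infinite sums beyond this is needed, and
general Laurent polynomials follow by additivity. -/
lemma HasProduct.update_single {f : κ → FPS σ} {h : FPS σ} (H : HasProduct f h) (k₀ : κ)
    (v : σ → ℤ) (a : ℂ) :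
    HasProduct (Function.update f k₀ (act (AddMonoidAlgebra.single v a) (f k₀)))
      (act (AddMonoidAlgebra.single v a) h) := by
  intro μ
  rw [act_single]
  let E : {ν : κ → σ → ℤ // ∑ k, ν k = μ} ≃ {ν : κ → σ → ℤ // ∑ k, ν k = μ - v} :=
    (Equiv.subRight (Pi.single k₀ v)).subtypeEquiv fun ν => by
      simp [Finset.sum_sub_distrib]
  refine (E.hasSum_iff.mpr ((H (μ - v)).mul_left a)).congr_fun fun ν => ?_
  rw [prod_update_apply, act_single, Function.comp_apply,
    ← Finset.mul_prod_erase _ _ (Finset.mem_univ k₀), mul_assoc]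
  have h1 : ∀ k, (E ν).1 k = ν.1 k - (Pi.single k₀ v : κ → σ → ℤ) k := fun k => rfl
  rw [h1, Pi.single_eq_same]
  congr 2
  exact Finset.prod_congr rfl fun k hk => by
    rw [h1, Pi.single_eq_of_ne (Finset.ne_of_mem_erase hk), sub_zero]

lemma HasProduct.update_add {f : κ → FPS σ} {k₀ : κ} {g₁ g₂ h₁ h₂ : FPS σ}
    (H₁ : HasProduct (Function.update f k₀ g₁) h₁)
    (H₂ : HasProduct (Function.update f k₀ g₂) h₂) :
    HasProduct (Function.update f k₀ (g₁ + g₂)) (h₁ + h₂) := by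
  intro μ
  refine ((H₁ μ).add (H₂ μ)).congr_fun fun ν => ?_
  simp only [prod_update_apply, Pi.add_apply, add_mul]

lemma hasProduct_update_zero (f : κ → FPS σ) (k₀ : κ) :
    HasProduct (Function.update f k₀ 0) 0 := by
  intro μ
  simp only [prod_update_apply, Pi.zero_apply, zero_mul]
  exact hasSum_zero

lemma HasProduct.update_act {f : κ → FPS σ} {h : FPS σ} (H : HasProduct f h) (k₀ : κ)
    (p : Laurent σ) : HasProduct (Function.update f k₀ (act p (f k₀))) (act p h) := by
  induction p using AddMonoidAlgebra.induction_linear with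
  | zero => simpa using hasProduct_update_zero f k₀
  | add p p' hp hp' => simpa only [map_add, LinearMap.add_apply] using hp.update_add hp'
  | single v a => exact H.update_single k₀ v a

/-- Multiplying the factors of an existing product by Laurent polynomials. -/
theorem HasProduct.act {f : κ → FPS σ} {h : FPS σ} (H : HasProduct f h) (p : κ → Laurent σ) :
    HasProduct (fun k => act (p k) (f k)) (act (∏ k, p k) h) := by
  suffices hs : ∀ s : Finset κ, HasProduct
      (fun k => if k ∈ s then SerreSeries.act (p k) (f k) else f k)
      (SerreSeries.act (∏ k ∈ s, p k) h) by
    simpa using hs Finset.univ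
  intro s
  induction s using Finset.induction_on with
  | empty => simpa using H
  | insert a s ha ih =>
    rw [Finset.prod_insert ha, act_mul]
    convert ih.update_act a (p a) using 1
    funext k
    by_cases hk : k = a
    · subst hk; simp [ha]
    · simp [hk]

end Update

/-- The series `1`. -/
def oneSeries (σ : Type) [DecidableEq σ] [Fintype σ] : FPS σ := Pi.single 0 1

variable [DecidableEq σ] [Fintype σ]

lemma hasProduct_one : HasProduct (fun _ : κ => oneSeries σ) (oneSeries σ) := by
  intro μ
  by_cases hμ : μ = 0
  · subst hμ
    convert hasSum_single (⟨0, by simp⟩ : {ν : κ → σ → ℤ // ∑ k, ν k = 0}) ?_ using 1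
    · simp [oneSeries]
    · intro ν hν
      obtain ⟨k, hk⟩ : ∃ k, ν.1 k ≠ 0 := by
        by_contra! h
        exact hν (Subtype.ext (funext h))
      exact Finset.prod_eq_zero (Finset.mem_univ k) (by simp [oneSeries, hk])
  · rw [oneSeries, Pi.single_eq_of_ne hμ]
    convert hasSum_zero using 1
    funext ν
    obtain ⟨k, hk⟩ : ∃ k, ν.1 k ≠ 0 := by
      by_contra! h
      exact hμ (by rw [← ν.2]; exact Finset.sum_eq_zero fun k _ => h k)
    exact Finset.prod_eq_zero (Finset.mem_univ k) (by simp [hk])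

/-- A product with all factors but one equal to 1 exists for every `g`, since each coefficient has
at most one nonzero term. -/
lemma hasProduct_update_one [DecidableEq κ] (k₀ : κ) (g : FPS σ) :
    HasProduct (Function.update (fun _ => oneSeries σ) k₀ g) g := by
  intro μ
  convert hasSum_single (⟨Pi.single k₀ μ, by simp⟩ : {ν : κ → σ → ℤ // ∑ k, ν k = μ}) ?_ using 1
  · rw [prod_update_apply, Finset.prod_eq_one, mul_one]
    · simp
    · intro k hk
      simp [oneSeries, Pi.single_eq_of_ne (Finset.ne_of_mem_erase hk)]
  · intro ν hν
    obtain ⟨k, hk, hk'⟩ : ∃ k, k ≠ k₀ ∧ ν.1 k ≠ 0 := by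
      by_contra! h
      refine hν (Subtype.ext (funext fun k => ?_))
      by_cases hk : k = k₀
      · subst hk
        refine Eq.trans ?_ (ν.2.trans (Pi.single_eq_same (M := fun _ => σ → ℤ) k μ).symm)
        exact (Finset.sum_eq_single k (fun j _ hj => h j hj) (by simp)).symm
      · exact (h k hk).trans (Pi.single_eq_of_ne (M := fun _ => σ → ℤ) hk μ).symm
    rw [prod_update_apply, Finset.prod_eq_zero (Finset.mem_erase.mpr ⟨hk, Finset.mem_univ k⟩)
      (by simp [oneSeries, hk']), mul_zero]

end HasProduct

/-! ### Absolute convergence of products -/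

section Summability

lemma summable_prod_apply {κ α : Type*} [Fintype κ] {g : κ → α → ℝ} (hg : ∀ k x, 0 ≤ g k x)
    (hs : ∀ k, Summable (g k)) : Summable fun ν : κ → α => ∏ k, g k (ν k) := by
  classical
  refine summable_of_sum_le (c := ∏ k, ∑' x, g k x)
    (fun ν => Finset.prod_nonneg fun k _ => hg k _) fun S => ?_
  calc ∑ ν ∈ S, ∏ k, g k (ν k)
      ≤ ∑ ν ∈ Fintype.piFinset fun k => S.image fun ν => ν k, ∏ k, g k (ν k) := by
        refine Finset.sum_le_sum_of_subset_of_nonneg (fun ν hν => ?_)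
          fun ν _ _ => Finset.prod_nonneg fun k _ => hg k _
        exact Fintype.mem_piFinset.mpr fun k => Finset.mem_image_of_mem _ hν
    _ = ∏ k, ∑ x ∈ S.image fun ν => ν k, g k x := (Finset.prod_univ_sum _ _).symm
    _ ≤ ∏ k, ∑' x, g k x :=
        Finset.prod_le_prod (fun k _ => Finset.sum_nonneg fun _ _ => hg k _)
          fun k _ => (hs k).sum_le_tsum _ fun _ _ => hg k _

lemma productExists_of_summable_norm {σ κ : Type} [DecidableEq σ] [Fintype σ] [Fintype κ]
    {f : κ → FPS σ}
    (hf : ∀ k, Summable fun μ => ‖f k μ‖) : ProductExists f := by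
  intro μ
  have h : Summable fun ν : κ → σ → ℤ => ∏ k, f k (ν k) := by
    refine Summable.of_norm ?_
    simp only [norm_prod]
    exact summable_prod_apply (g := fun k μ => ‖f k μ‖) (fun _ _ => norm_nonneg _) hf
  exact h.comp_injective Subtype.val_injective

end Summability

/-! ### Series in a ratio of two variables -/

section RatioSubst

variable {σ : Type} [DecidableEq σ]

/-- The variable `x s` as a Laurent polynomial. -/
def var (s : σ) : Laurent σ := AddMonoidAlgebra.single (Pi.single s 1) 1

lemma isUnit_var (s : σ) : IsUnit (var s) :=
  IsUnit.of_mul_eq_one (AddMonoidAlgebra.single (-Pi.single s 1) 1) (by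
    simp [var, AddMonoidAlgebra.single_mul_single, AddMonoidAlgebra.one_def])

variable [Fintype σ]

lemma ratioSubst_smul (f : BiSeries) (s t : σ) (n : ℤ) (hst : s ≠ t) :
    ratioSubst f s t (n • (Pi.single s 1 - Pi.single t 1)) = f n := by
  have h : (n • (Pi.single s 1 - Pi.single t 1 : σ → ℤ)) s = n := by simp [hst]
  rw [ratioSubst, h, if_pos rfl]

lemma ratioSubst_of_notMem_range (f : BiSeries) (s t : σ) (μ : σ → ℤ)
    (hμ : μ ∉ Set.range fun n : ℤ => n • (Pi.single s 1 - Pi.single t 1 : σ → ℤ)) :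
    ratioSubst f s t μ = 0 :=
  if_neg fun h => hμ ⟨μ s, h.symm⟩

lemma ratioSubst_swap (f : BiSeries) {s t : σ} (hst : s ≠ t) :
    ratioSubst f t s = ratioSubst f.inv s t := by
  funext μ
  by_cases hμ : μ ∈ Set.range fun n : ℤ => n • (Pi.single s 1 - Pi.single t 1 : σ → ℤ)
  · obtain ⟨n, rfl⟩ := hμ
    have h : n • (Pi.single s 1 - Pi.single t 1 : σ → ℤ) =
        (-n) • (Pi.single t 1 - Pi.single s 1) := by
      rw [neg_smul, ← smul_neg, neg_sub]
    beta_reduce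
    rw [ratioSubst_smul _ _ _ _ hst, h, ratioSubst_smul _ _ _ _ hst.symm, BiSeries.inv]
  · rw [ratioSubst_of_notMem_range _ _ _ _ hμ, ratioSubst_of_notMem_range]
    rintro ⟨n, rfl⟩
    refine hμ ⟨-n, ?_⟩
    beta_reduce
    rw [neg_smul, ← smul_neg, neg_sub]

lemma act_single_ratioSubst (a : ℂ) (f : BiSeries) {s t : σ} (hst : s ≠ t) :
    act (AddMonoidAlgebra.single (Pi.single s 1 - Pi.single t 1) a) (ratioSubst f s t) =
      ratioSubst (fun n => a * f (n - 1)) s t := by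
  funext μ
  rw [act_single]
  by_cases hμ : μ ∈ Set.range fun n : ℤ => n • (Pi.single s 1 - Pi.single t 1 : σ → ℤ)
  · obtain ⟨n, rfl⟩ := hμ
    beta_reduce
    have h : n • (Pi.single s 1 - Pi.single t 1 : σ → ℤ) - (Pi.single s 1 - Pi.single t 1) =
        (n - 1) • (Pi.single s 1 - Pi.single t 1) := by
      rw [sub_smul, one_smul]
    rw [ratioSubst_smul _ _ _ _ hst, h, ratioSubst_smul _ _ _ _ hst]
  · rw [ratioSubst_of_notMem_range _ _ _ _ hμ, ratioSubst_of_notMem_range, mul_zero]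
    rintro ⟨n, hn⟩
    refine hμ ⟨n + 1, ?_⟩
    beta_reduce at hn ⊢
    rw [add_smul, one_smul, hn, sub_add_cancel]

lemma ratioSubst_add (f g : BiSeries) (s t : σ) :
    ratioSubst (f + g) s t = ratioSubst f s t + ratioSubst g s t := by
  funext μ
  simp only [ratioSubst, Pi.add_apply]
  split_ifs <;> simp

lemma ratioSubst_const_smul (a : ℂ) (f : BiSeries) (s t : σ) :
    ratioSubst (a • f) s t = a • ratioSubst f s t := by
  funext μ
  simp only [ratioSubst, Pi.smul_apply]
  split_ifs <;> simp

/-- Homogenization: α s + β t = t (α (s/t) + β), and the second factor acts on a series in s/t as on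
a series in one variable. -/
lemma act_linear_ratioSubst (α β : ℂ) (f : BiSeries) {s t : σ} (hst : s ≠ t) :
    act (algebraMap ℂ _ α * var s + algebraMap ℂ _ β * var t) (ratioSubst f s t) =
      act (var t) (ratioSubst (BiSeries.linMul α β f) s t) := by
  have h : algebraMap ℂ (Laurent σ) α * var s + algebraMap ℂ _ β * var t =
      var t * (AddMonoidAlgebra.single (Pi.single s 1 - Pi.single t 1) α +
        algebraMap ℂ _ β) := by
    simp only [var, mul_add, AddMonoidAlgebra.coe_algebraMap, Function.comp_apply,
      AddMonoidAlgebra.single_mul_single, Algebra.algebraMap_self, RingHom.id_apply]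
    simp
  rw [h, act_mul, map_add, LinearMap.add_apply, act_single_ratioSubst _ _ hst, act_algebraMap,
    ← ratioSubst_const_smul, ← ratioSubst_add]
  rfl

/-- Relation (1) at z = s/t, multiplied by t. -/
lemma act_ratioSubst_eq {c : ℂ} {f g : BiSeries}
    (h : BiSeries.linMul 1 (-c) g.inv = BiSeries.linMul c (-1) f) {s t : σ} (hst : s ≠ t) :
    act (var s - algebraMap ℂ _ c * var t) (ratioSubst g t s) =
      act (algebraMap ℂ _ c * var s - var t) (ratioSubst f s t) := by
  have h1 := act_linear_ratioSubst 1 (-c) g.inv hst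
  have h2 := act_linear_ratioSubst c (-1) f hst
  rw [h, ← h2, ← ratioSubst_swap _ hst] at h1
  simpa only [map_one, one_mul, map_neg, neg_mul, ← sub_eq_add_neg] using h1

lemma linMul_geom (c : ℂ) : BiSeries.linMul (-c) 1 (BiSeries.geom c) = Pi.single 0 1 := by
  funext n
  rcases lt_trichotomy n 0 with hn | rfl | hn
  · have h1 : ¬ 0 ≤ n := by omega
    have h2 : ¬ 1 ≤ n := by omega
    simp [BiSeries.linMul, BiSeries.geom, h1, h2, hn.ne]
  · simp [BiSeries.linMul, BiSeries.geom]
  · obtain ⟨m, rfl⟩ : ∃ m : ℕ, n = m + 1 := ⟨(n - 1).toNat, by omega⟩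
    have h1 : (0 : ℤ) ≤ m + 1 := by omega
    have h2 : ((m : ℤ) + 1).toNat = m + 1 := by omega
    simp [BiSeries.linMul, BiSeries.geom, h1, h2, hn.ne', pow_succ']

lemma ratioSubst_single_zero (s t : σ) :
    ratioSubst (Pi.single 0 1) s t = oneSeries σ := by
  funext μ
  by_cases hμ : μ = 0
  · subst hμ; simp [ratioSubst, oneSeries]
  · simp only [ratioSubst, oneSeries, Pi.single_eq_of_ne hμ]
    split_ifs with h
    · refine Pi.single_eq_of_ne (fun h0 => hμ ?_) _
      rw [h, h0, zero_smul]
    · rfl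

/-- The homogenized form of (1 - c z) · 1/(1 - c z) = 1. -/
lemma act_ratioSubst_geom (c : ℂ) {s t : σ} (hst : s ≠ t) :
    act (var t - algebraMap ℂ _ c * var s) (ratioSubst (BiSeries.geom c) s t) =
      act (var t) (oneSeries σ) := by
  have h := act_linear_ratioSubst (-c) 1 (BiSeries.geom c) hst
  rw [linMul_geom, ratioSubst_single_zero] at h
  rw [← h, map_neg, map_one, neg_mul, one_mul, neg_add_eq_sub]

lemma summable_norm_ratioSubst_geom {c : ℂ} (hc : ‖c‖ < 1) {s t : σ} (hst : s ≠ t) :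
    Summable fun μ => ‖ratioSubst (BiSeries.geom c) s t μ‖ := by
  have hinj : Function.Injective
      fun n : ℕ => (n : ℤ) • (Pi.single s 1 - Pi.single t 1 : σ → ℤ) := by
    intro m n h
    have := congrFun h s
    simpa [hst] using this
  rw [← hinj.summable_iff]
  · convert summable_geometric_of_lt_one (norm_nonneg c) hc using 1
    funext n
    simp only [Function.comp_apply]
    rw [ratioSubst_smul _ _ _ _ hst]
    simp [BiSeries.geom]
  · intro μ hμ
    rw [norm_eq_zero]
    simp only [ratioSubst, BiSeries.geom]
    split_ifs with h1 h2
    · refine absurd ⟨(μ s).toNat, ?_⟩ hμ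
      beta_reduce
      rw [Int.toNat_of_nonneg h2, ← h1]
    · rfl
    · rfl

end RatioSubst

/-! ### Permutations acting on unordered pairs -/

section Pairs

open Equiv

variable {N : ℕ}

lemma prod_ltPairs {M : Type*} [CommMonoid M] (f : Fin N → Fin N → M) :
    ∏ x : LtPairs N, f x.1.1 x.1.2 = ∏ i, ∏ j ∈ Finset.Ioi i, f i j := by
  have h : ∀ i : Fin N, Finset.Ioi i = Finset.univ.filter fun j => i < j := by
    intro i; ext; simp
  simp only [h, Finset.prod_filter]
  rw [← Fintype.prod_prod_type' fun i j : Fin N => if i < j then f i j else 1,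
    ← Finset.prod_filter]
  exact (Finset.prod_subtype _ (by simp) fun x : Fin N × Fin N => f x.1 x.2).symm

lemma prod_nePairs {M : Type*} [CommMonoid M] (f : Fin N → Fin N → M) :
    ∏ x : NePairs N, f x.1.1 x.1.2 = ∏ x : LtPairs N, f x.1.1 x.1.2 * f x.1.2 x.1.1 := by
  have h : ∏ x : NePairs N, f x.1.1 x.1.2 = ∏ x : Fin N × Fin N with x.1 ≠ x.2, f x.1 x.2 :=
    (Finset.prod_subtype _ (by simp) fun x : Fin N × Fin N => f x.1 x.2).symm
  have h' : ∀ g : Fin N → Fin N → M, ∏ x : LtPairs N, g x.1.1 x.1.2 =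
      ∏ x : Fin N × Fin N with x.1 < x.2, g x.1 x.2 := fun g =>
    (Finset.prod_subtype _ (by simp) fun x : Fin N × Fin N => g x.1 x.2).symm
  rw [h, Finset.prod_mul_distrib, h' f, h' fun i j => f j i]
  have hswap : ∏ x : Fin N × Fin N with x.1 < x.2, f x.2 x.1 =
      ∏ x : Fin N × Fin N with x.2 < x.1, f x.1 x.2 :=
    Finset.prod_nbij' Prod.swap Prod.swap (by simp) (by simp) (by simp) (by simp) (by simp)
  rw [hswap, ← Finset.prod_union]
  · congr 1
    ext x
    simp [lt_or_lt_iff_ne]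
  · rw [Finset.disjoint_filter]
    exact fun x _ h => h.asymm

/-- The pair of the values of a permutation, in increasing order. -/
def sortPair (π : Perm (Fin N)) (x : LtPairs N) : LtPairs N :=
  ⟨(min (π x.1.1) (π x.1.2), max (π x.1.1) (π x.1.2)),
    min_lt_max.mpr (π.injective.ne x.2.ne)⟩

lemma sortPair_of_lt {π : Perm (Fin N)} {x : LtPairs N} (h : π x.1.1 < π x.1.2) :
    (sortPair π x).1 = (π x.1.1, π x.1.2) := by
  simp [sortPair, h.le]

lemma sortPair_of_gt {π : Perm (Fin N)} {x : LtPairs N} (h : π x.1.2 < π x.1.1) :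
    (sortPair π x).1 = (π x.1.2, π x.1.1) := by
  simp [sortPair, h.le]

lemma sortPair_sortPair {π ρ : Perm (Fin N)} (h : ∀ r, ρ (π r) = r) (x : LtPairs N) :
    sortPair ρ (sortPair π x) = x := by
  apply Subtype.ext
  have hx := x.2
  rcases (π.injective.ne x.2.ne).lt_or_gt with hlt | hgt
  · have h1 := sortPair_of_lt hlt
    rw [sortPair_of_lt (by rw [h1]; simpa only [h] using hx), h1]
    simp [h]
  · have h1 := sortPair_of_gt hgt
    rw [sortPair_of_gt (by rw [h1]; simpa only [h] using hx), h1]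
    simp [h]

/-- The permutation of the set of unordered pairs induced by `π`. -/
def pairPerm (π : Perm (Fin N)) : LtPairs N ≃ LtPairs N where
  toFun := sortPair π
  invFun := sortPair π.symm
  left_inv := sortPair_sortPair π.symm_apply_apply
  right_inv := sortPair_sortPair π.apply_symm_apply

/-- Each inversion of π contributes -1. -/
lemma prod_ltPairs_ite_eq_sign {R : Type*} [CommRing R] (π : Perm (Fin N)) :
    ∏ x : LtPairs N, (if π x.1.1 < π x.1.2 then 1 else -1 : R) = ((Perm.sign π : ℤ) : R) := by
  rw [Perm.sign_eq_prod_prod_Ioi, ← prod_ltPairs fun i j => if π i < π j then (1 : ℤˣ) else -1,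
    Units.coe_prod, Int.cast_prod]
  refine Finset.prod_congr rfl fun x _ => ?_
  split_ifs <;> simp

end Pairs

/-! ### Clearing denominators in the Serre expression -/

section Clearing

open Equiv

variable {N : ℕ}

section Factors

variable {R : Type*} [CommRing R]

/-- The product `∏_{p ≠ q} (z_p - c z_q)`, arranged by unordered pairs. -/
def pairDenominator (c : R) (z : Fin N → R) : R :=
  ∏ x : LtPairs N, (z x.1.1 - c * z x.1.2) * (z x.1.2 - c * z x.1.1)

/-- The common denominator `∏_{p ≠ q} (z_p - c z_q) ∏_s (w - b z_s)`. -/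
def denominator (c b w : R) (z : Fin N → R) : R :=
  pairDenominator c z * ∏ r : Fin N, (w - b * z r)

/-- The common denominator, distributed over the factors of the term of `π`. -/
def denominatorFactor (c b w : R) (z : Fin N → R) (π : Perm (Fin N)) : LtPairs N ⊕ Fin N → R
  | Sum.inl x => (z (π x.1.1) - c * z (π x.1.2)) * (z (π x.1.2) - c * z (π x.1.1))
  | Sum.inr r => w - b * z (π r)

/-- The quotients of the factors of a term, with denominators cleared, by those of a fixed one. -/
def numeratorFactor (c b w : R) (z : Fin N → R) (π : Perm (Fin N)) (k : ℕ) :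
    LtPairs N ⊕ Fin N → R
  | Sum.inl x => (z (sortPair π x).1.1 - c * z (sortPair π x).1.2) *
      ((if π x.1.1 < π x.1.2 then 1 else -1) * (z (π x.1.2) - c * z (π x.1.1)))
  | Sum.inr r => if r.val < k then w - b * z (π r) else b * w - z (π r)

/-- The factor of a pair is symmetric in its two elements, so π only permutes the factors. -/
lemma prod_denominatorFactor (c b w : R) (z : Fin N → R) (π : Perm (Fin N)) :
    ∏ y, denominatorFactor c b w z π y = denominator c b w z := by
  rw [Fintype.prod_sum_type, denominator, pairDenominator,
    ← Equiv.prod_comp (pairPerm π)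
      fun x : LtPairs N => (z x.1.1 - c * z x.1.2) * (z x.1.2 - c * z x.1.1),
    ← Equiv.prod_comp π fun r => w - b * z r]
  simp only [denominatorFactor]
  congr 1
  refine Finset.prod_congr rfl fun x _ => ?_
  change _ = (z (sortPair π x).1.1 - c * z (sortPair π x).1.2) *
    (z (sortPair π x).1.2 - c * z (sortPair π x).1.1)
  rcases (π.injective.ne x.2.ne).lt_or_gt with hlt | hgt
  · rw [sortPair_of_lt hlt]
  · rw [sortPair_of_gt hgt, mul_comm]

/-- Reindexing by unordered pairs frees the first product from π. It is thus common to all terms,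
and what remains is the summand of the polynomial identity. -/
lemma prod_numeratorFactor (c b w : R) (z : Fin N → R) (π : Perm (Fin N)) (k : ℕ) :
    ∏ y, numeratorFactor c b w z π k y =
      (∏ x : LtPairs N, (z x.1.1 - c * z x.1.2)) *
        (((Perm.sign π : ℤ) : R) * qVandermonde c (z ∘ π) *
          ∏ r : Fin N, (if r.val < k then w - b * z (π r) else b * w - z (π r))) := by
  rw [Fintype.prod_sum_type]
  simp only [numeratorFactor]
  rw [Finset.prod_mul_distrib, Finset.prod_mul_distrib, prod_ltPairs_ite_eq_sign, mul_assoc,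
    ← Equiv.prod_comp (pairPerm π) fun x : LtPairs N => z x.1.1 - c * z x.1.2]
  rfl

end Factors

/-- The variables `z_1, …, z_N` as Laurent polynomials. -/
def zVar (N : ℕ) (r : Fin N) : Laurent (Vars N) := var (some r)

/-- The variable `w` as a Laurent polynomial. -/
def wVar (N : ℕ) : Laurent (Vars N) := var none

/-- Constants as Laurent polynomials. -/
abbrev const (N : ℕ) (c : ℂ) : Laurent (Vars N) := algebraMap ℂ (Laurent (Vars N)) c

/-- Factor by factor comparison with the reference term π = 1, k = N. A pair in the right order
already agrees with its reference factor; an inverted pair is turned around by relation (1) for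
F_ii, which produces the sign -1. Likewise a factor F_ij(z/w) is turned into F_ji(w/z) by relation
(1). -/
lemma act_denominatorFactor {c b : ℂ} {Fii Fij Fji : BiSeries}
    (hii : BiSeries.linMul 1 (-c) Fii.inv = BiSeries.linMul c (-1) Fii)
    (hij : BiSeries.linMul 1 (-b) Fji.inv = BiSeries.linMul b (-1) Fij)
    (π : Perm (Fin N)) (k : ℕ) (y : LtPairs N ⊕ Fin N) :
    act (denominatorFactor (const N c) (const N b) (wVar N) (zVar N) π y)
        (termFactors Fii Fij Fji π k y) =
      act (numeratorFactor (const N c) (const N b) (wVar N) (zVar N) π k y)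
        (termFactors Fii Fij Fji 1 N ((pairPerm π).sumCongr π y)) := by
  rcases y with x | r
  · change act ((zVar N (π x.1.1) - const N c * zVar N (π x.1.2)) *
        (zVar N (π x.1.2) - const N c * zVar N (π x.1.1)))
        (ratioSubst Fii (some (π x.1.2)) (some (π x.1.1))) =
      act ((zVar N (sortPair π x).1.1 - const N c * zVar N (sortPair π x).1.2) *
        ((if π x.1.1 < π x.1.2 then 1 else -1) * (zVar N (π x.1.2) - const N c * zVar N (π x.1.1))))
        (ratioSubst Fii (some (sortPair π x).1.2) (some (sortPair π x).1.1))
    rcases (π.injective.ne x.2.ne).lt_or_gt with hlt | hgt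
    · rw [sortPair_of_lt hlt, if_pos hlt, one_mul]
    · have h1 := act_ratioSubst_eq hii
        (fun h => hgt.ne' (Option.some_injective _ h) : (some (π x.1.1) : Vars N) ≠ some (π x.1.2))
      rw [sortPair_of_gt hgt, if_neg hgt.asymm, neg_one_mul, neg_sub, mul_comm, act_mul, act_mul]
      exact congrArg _ h1
  · change act (wVar N - const N b * zVar N (π r)) (if r.val < k
        then ratioSubst Fji none (some (π r)) else ratioSubst Fij (some (π r)) none) =
      act (if r.val < k then wVar N - const N b * zVar N (π r)
          else const N b * wVar N - zVar N (π r))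
        (if (π r).val < N then ratioSubst Fji none (some (π r))
          else ratioSubst Fij (some (π r)) none)
    -- In the reference term k = N, so every factor containing w is of the form F_ji(w/z).
    rw [if_pos (π r).is_lt]
    split_ifs with h
    · rfl
    · have h1 := act_ratioSubst_eq hij (Option.some_ne_none (π r))
      have h2 := congrArg Neg.neg h1
      rw [← LinearMap.neg_apply, ← LinearMap.neg_apply, ← map_neg, ← map_neg, neg_sub,
        neg_sub] at h2
      exact h2.symm

/-- All terms of the Serre expression are multiples of one series after clearing denominators. -/
lemma act_denominator_product_termFactors {c b : ℂ} {Fii Fij Fji : BiSeries}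
    (hii : BiSeries.linMul 1 (-c) Fii.inv = BiSeries.linMul c (-1) Fii)
    (hij : BiSeries.linMul 1 (-b) Fji.inv = BiSeries.linMul b (-1) Fij)
    (hP : ∀ (π : Perm (Fin N)) (k : ℕ), k ≤ N → ProductExists (termFactors Fii Fij Fji π k))
    (π : Perm (Fin N)) (k : ℕ) (hk : k ≤ N) :
    act (denominator (const N c) (const N b) (wVar N) (zVar N))
        (product (termFactors Fii Fij Fji π k)) =
      act ((∏ x : LtPairs N, (zVar N x.1.1 - const N c * zVar N x.1.2)) *
        (((Perm.sign π : ℤ) : Laurent (Vars N)) * qVandermonde (const N c) (zVar N ∘ π) *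
          ∏ r : Fin N, (if r.val < k then wVar N - const N b * zVar N (π r)
            else const N b * wVar N - zVar N (π r))))
        (product (termFactors Fii Fij Fji 1 N)) := by
  have H := (hP π k hk).hasProduct.act
    (denominatorFactor (const N c) (const N b) (wVar N) (zVar N) π)
  have H' := ((hP 1 N le_rfl).hasProduct.comp_equiv ((pairPerm π).sumCongr π)).act
    (numeratorFactor (const N c) (const N b) (wVar N) (zVar N) π k)
  simp only [act_denominatorFactor hii hij] at H
  rw [← prod_numeratorFactor, ← prod_denominatorFactor _ _ _ _ π]
  exact H.unique H'

/-- The Serre expression vanishes after clearing denominators. -/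
lemma act_denominator_serreSum {n : ℕ} {t : ℂ} (ht0 : t ≠ 0) (ht : ∀ m : ℕ, 0 < m → t ^ m ≠ 1)
    {Fii Fij Fji : BiSeries}
    (hii : BiSeries.linMul 1 (-(t ^ 2)) Fii.inv = BiSeries.linMul (t ^ 2) (-1) Fii)
    (hij : BiSeries.linMul 1 (-(t ^ (-(n : ℤ)))) Fji.inv =
      BiSeries.linMul (t ^ (-(n : ℤ))) (-1) Fij)
    (hP : ∀ (π : Perm (Fin (n + 1))) (k : ℕ), k ≤ n + 1 →
      ProductExists (termFactors Fii Fij Fji π k)) :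
    act (denominator (const (n + 1) (t ^ 2)) (const (n + 1) (t ^ (-(n : ℤ)))) (wVar (n + 1))
      (zVar (n + 1))) (serreSum (n + 1) t Fii Fij Fji) = 0 := by
  have hid := sum_sign_mul_qVandermonde_mul_eq_zero ht0 ht (zVar (n + 1)) (wVar (n + 1))
  -- The polynomial identity, multiplied by the common factor, is applied to the reference series.
  have h := congrArg (fun p => act ((∏ x : LtPairs (n + 1),
    (zVar (n + 1) x.1.1 - const (n + 1) (t ^ 2) * zVar (n + 1) x.1.2)) * p)
      (product (termFactors Fii Fij Fji 1 (n + 1)))) hid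
  simp only [mul_zero, map_zero, LinearMap.zero_apply] at h
  rw [← h, serreSum]
  simp only [map_sum, Finset.mul_sum, LinearMap.sum_apply]
  refine Finset.sum_congr rfl fun π _ => Finset.sum_congr rfl fun k hk => ?_
  rw [map_smul, act_denominator_product_termFactors hii hij hP π k
    (by have := Finset.mem_range.mp hk; omega), ← act_algebraMap, ← act_mul, mul_left_comm]

end Clearing

/-! ### Cancelling the denominators by geometric series -/

section Geometric

variable {N : ℕ}

/-- Both z_r/z_p and z_p/z_r occur, so the coefficients are infinite sums; |c| < 1 makes them
converge absolutely. -/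
lemma act_geomZZ {c : ℂ} (hc : ‖c‖ < 1) :
    act (pairDenominator (const N c) (zVar N)) (geomZZ N c) =
      act (∏ x : NePairs N, zVar N x.1.1) (oneSeries (Vars N)) := by
  have hne : ∀ x : NePairs N, (some x.1.2 : Vars N) ≠ some x.1.1 :=
    fun x h => x.2 (Option.some_injective _ h).symm
  have H := (productExists_of_summable_norm fun x : NePairs N =>
    summable_norm_ratioSubst_geom hc (hne x)).hasProduct.act
      fun x => zVar N x.1.1 - const N c * zVar N x.1.2
  have H' := (hasProduct_one (σ := Vars N) (κ := NePairs N)).act fun x => zVar N x.1.1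
  have h1 : ∀ x : NePairs N, act (zVar N x.1.1 - const N c * zVar N x.1.2)
      (ratioSubst (BiSeries.geom c) (some x.1.2) (some x.1.1)) =
        act (zVar N x.1.1) (oneSeries (Vars N)) := fun x => act_ratioSubst_geom c (hne x)
  simp only [h1] at H
  rw [prod_nePairs fun i j : Fin N => zVar N i - const N c * zVar N j] at H
  exact H.unique H'

/-- The exponent of z_s determines the power of z_s/w, so each coefficient has at most one nonzero
term. No bound on c is needed, which matters because |q^{b_ij}| ≥ 1. -/
lemma productExists_geomZW (c : ℂ) :
    ProductExists fun s : Fin N => (ratioSubst (BiSeries.geom c) (some s) none : FPS (Vars N)) := by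
  intro μ
  refine summable_of_hasFiniteSupport ?_
  have key : ∀ ν : {ν : Fin N → Vars N → ℤ // ∑ k, ν k = μ},
      ∏ k, ratioSubst (BiSeries.geom c) (some k) none (ν.1 k) ≠ 0 →
      ∀ s, ν.1 s = μ (some s) • (Pi.single (some s) 1 - Pi.single none 1 : Vars N → ℤ) := by
    intro ν hν
    have h1 : ∀ s, ν.1 s = ν.1 s (some s) •
        (Pi.single (some s) 1 - Pi.single none 1 : Vars N → ℤ) := by
      intro s
      by_contra h
      exact Finset.prod_ne_zero_iff.mp hν s (Finset.mem_univ s) (if_neg h)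
    intro s
    have h2 : ν.1 s (some s) = μ (some s) := by
      have h3 : ∑ r, ν.1 r (some s) = ν.1 s (some s) := by
        refine Finset.sum_eq_single s (fun r _ hr => ?_) (by simp)
        rw [h1 r]
        simp [hr.symm]
      rw [← h3, ← Finset.sum_apply]
      exact congrFun ν.2 (some s)
    rw [← h2]
    exact h1 s
  refine Set.Subsingleton.finite fun ν hν ν' hν' => ?_
  exact Subtype.ext (funext fun s => (key ν hν s).trans (key ν' hν' s).symm)

lemma act_geomZW (c : ℂ) :
    act (∏ r : Fin N, (wVar N - const N c * zVar N r)) (geomZW N c) =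
      act (∏ _r : Fin N, wVar N) (oneSeries (Vars N)) := by
  have H := (productExists_geomZW (N := N) c).hasProduct.act
    fun s => wVar N - const N c * zVar N s
  have H' := (hasProduct_one (σ := Vars N) (κ := Fin N)).act fun _ => wVar N
  have h1 : ∀ s : Fin N, act (wVar N - const N c * zVar N s)
      (ratioSubst (BiSeries.geom c) (some s) none) = act (wVar N) (oneSeries (Vars N)) :=
    fun s => act_ratioSubst_geom c (Option.some_ne_none s)
  simp only [h1] at H
  exact H.unique H'

/-- If the product of the geometric factors with `P` exists, then denominators cancel in `P`. -/
lemma eq_zero_of_act_denominator_eq_zero {c b : ℂ} (hc : ‖c‖ < 1) {P : FPS (Vars N)}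
    (hG : ProductExists ![geomZZ N c, geomZW N b, P])
    (hP : act (denominator (const N c) (const N b) (wVar N) (zVar N)) P = 0) : P = 0 := by
  have H := hG.hasProduct
  -- The denominator acts on the triple product in two ways: split between the two geometric series
  -- (`H₁`), where it leaves a monomial times `P` (`H₃`), or placed entirely on `P` (`H₂`), where it
  -- gives 0.
  have H₁ := H.act ![pairDenominator (const N c) (zVar N),
    ∏ r : Fin N, (wVar N - const N b * zVar N r), 1]
  have H₂ := H.act ![1, 1, denominator (const N c) (const N b) (wVar N) (zVar N)]
  have H₃ := (hasProduct_update_one (κ := Fin 3) 2 P).act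
    ![∏ x : NePairs N, zVar N x.1.1, ∏ _r : Fin N, wVar N, 1]
  have e₁ : act (denominator (const N c) (const N b) (wVar N) (zVar N))
      (product ![geomZZ N c, geomZW N b, P]) =
      act ((∏ x : NePairs N, zVar N x.1.1) * ∏ _r : Fin N, wVar N) P := by
    rw [Fin.prod_univ_three] at H₁ H₃
    have h : ∀ k : Fin 3, act ((![pairDenominator (const N c) (zVar N),
          ∏ r : Fin N, (wVar N - const N b * zVar N r), 1] : Fin 3 → Laurent (Vars N)) k)
          ((![geomZZ N c, geomZW N b, P] : Fin 3 → FPS (Vars N)) k) =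
        act ((![∏ x : NePairs N, zVar N x.1.1, ∏ _r : Fin N, wVar N, 1] :
          Fin 3 → Laurent (Vars N)) k)
          (Function.update (fun _ : Fin 3 => oneSeries (Vars N)) 2 P k) := by
      intro k
      fin_cases k
      · exact act_geomZZ hc
      · exact act_geomZW b
      · rfl
    simp only [h] at H₁
    have := H₁.unique H₃
    rwa [Matrix.cons_val_two, Matrix.tail_cons, Matrix.head_cons, Matrix.cons_val_two,
      Matrix.tail_cons, Matrix.head_cons, mul_one, mul_one] at this
  have e₂ : act (denominator (const N c) (const N b) (wVar N) (zVar N))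
      (product ![geomZZ N c, geomZW N b, P]) = 0 := by
    rw [Fin.prod_univ_three] at H₂
    have h : ∀ k : Fin 3, act ((![1, 1, denominator (const N c) (const N b) (wVar N) (zVar N)] :
          Fin 3 → Laurent (Vars N)) k)
          ((![geomZZ N c, geomZW N b, P] : Fin 3 → FPS (Vars N)) k) =
        Function.update (![geomZZ N c, geomZW N b, P] : Fin 3 → FPS (Vars N)) 2 0 k := by
      intro k
      fin_cases k
      · exact LinearMap.congr_fun (map_one act) (geomZZ N c)
      · exact LinearMap.congr_fun (map_one act) (geomZW N b)
      · exact hP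
    simp only [h] at H₂
    have := H₂.unique (hasProduct_update_zero _ 2)
    rwa [Matrix.cons_val_zero, Matrix.cons_val_one, Matrix.cons_val_zero, one_mul, one_mul] at this
  refine act_eq_zero_of_isUnit ?_ (e₁.symm.trans e₂)
  exact (IsUnit.prod_univ_iff.mpr fun x => isUnit_var _).mul
    (IsUnit.prod_univ_iff.mpr fun r => isUnit_var _)

end Geometric

end SerreSeries

end

/-! ### Specialization to t = q^{d_i} -/

theorem theorem10 (l : ℕ) (a : Fin l → Fin l → ℤ) (d : Fin l → ℕ)
    (ha : SerreSeries.IsSymmetrizedGCM a d)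
    (q : ℂ) (hq0 : 0 < ‖q‖) (hq1 : ‖q‖ < 1)
    (F : Fin l → Fin l → SerreSeries.BiSeries)
    -- the equations `(z - q^{b_ij}) F_ji(z⁻¹) = (q^{b_ij} z - 1) F_ij(z)` for `a_ij ≠ 0`
    (hF : ∀ m n : Fin l, a m n ≠ 0 →
      SerreSeries.BiSeries.linMul 1 (-(q ^ SerreSeries.symmetrized a d m n)) (F n m).inv =
        SerreSeries.BiSeries.linMul (q ^ SerreSeries.symmetrized a d m n) (-1) (F m n))
    (i j : Fin l) (hij : i ≠ j)
    -- if `a_ij = 0`, the equation is also required for this pair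
    (hF0 : a i j = 0 →
      SerreSeries.BiSeries.linMul 1 (-(q ^ SerreSeries.symmetrized a d i j)) (F j i).inv =
        SerreSeries.BiSeries.linMul (q ^ SerreSeries.symmetrized a d i j) (-1) (F i j))
    (N : ℕ) (hN : (N : ℤ) = 1 - a i j)
    -- the products of series that make up `P_ij` exist
    (hP : ∀ (π : Equiv.Perm (Fin N)) (k : ℕ), k ≤ N →
      SerreSeries.ProductExists (SerreSeries.termFactors (F i i) (F i j) (F j i) π k))
    -- the product of the two geometric factors and `P_ij` exists
    (hG : SerreSeries.ProductExists
      ![SerreSeries.geomZZ N (q ^ SerreSeries.symmetrized a d i i),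
        SerreSeries.geomZW N (q ^ SerreSeries.symmetrized a d i j),
        SerreSeries.serreSum N (q ^ d i) (F i i) (F i j) (F j i)]) :
    SerreSeries.serreSum N (q ^ d i) (F i i) (F i j) (F j i) = 0 := by
  obtain ⟨n, rfl⟩ : ∃ n, N = n + 1 := by
    have := ha.nonpos i j hij
    exact ⟨N - 1, by omega⟩
  have hq : q ≠ 0 := norm_pos_iff.mp hq0
  have ht0 : q ^ d i ≠ 0 := pow_ne_zero _ hq
  -- This bound is used twice: it shows that t is not a root of unity, so the q-factorials are
  -- nonzero, and for m = 2 it gives |q^{b_ii}| < 1.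
  have hnorm : ∀ m : ℕ, 0 < m → ‖(q ^ d i) ^ m‖ < 1 := fun m hm => by
    rw [← pow_mul, norm_pow]
    exact pow_lt_one₀ hq0.le hq1 (Nat.mul_pos (ha.d_pos i) hm).ne'
  have ht : ∀ m : ℕ, 0 < m → (q ^ d i) ^ m ≠ 1 := fun m hm h => by
    simpa [h] using hnorm m hm
  have hbii : q ^ SerreSeries.symmetrized a d i i = (q ^ d i) ^ 2 := by
    rw [SerreSeries.symmetrized, ha.diag, zpow_mul, zpow_natCast]
    rfl
  have hbij : q ^ SerreSeries.symmetrized a d i j = (q ^ d i) ^ (-(n : ℤ)) := by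
    have : a i j = -(n : ℤ) := by push_cast at hN; linarith
    rw [SerreSeries.symmetrized, this, zpow_mul, zpow_natCast]
  have hii := hF i i (by rw [ha.diag]; norm_num)
  have hij' : SerreSeries.BiSeries.linMul 1 (-(q ^ SerreSeries.symmetrized a d i j)) (F j i).inv =
      SerreSeries.BiSeries.linMul (q ^ SerreSeries.symmetrized a d i j) (-1) (F i j) :=
    (eq_or_ne (a i j) 0).elim hF0 (hF i j)
  rw [hbii] at hii hG
  rw [hbij] at hij' hG
  exact SerreSeries.eq_zero_of_act_denominator_eq_zero (hnorm 2 two_pos) hG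
    (SerreSeries.act_denominator_serreSum ht0 ht hii hij' hP)
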